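/- Fix $\rho>0$ and an integer $N\ge 1$. Write $D(0,\rho)$ and $\overline D(0,\rho)$ for the open and closed discs of radius $\rho$ about $0$ in $\mathbb C$, $\mathcal P_N(K)$ for the set of positive semidefinite (Hermitian) $N\times N$ matrices with entries in $K\subset\mathbb C$, $A^{\circ k}=(a_{ij}^k)$ for the entrywise power (so $A^{\circ 0}$ is the all-ones matrix), and $g[A]=(g(a_{ij}))$. Let $\mathbf c=(c_0,\dots,c_{N-1})\in(0,\infty)^N$, and let $g(z)=\sum_{M\ge N}c_Mz^M$ be a power series with real coefficients that is analytic on $D(0,\rho)$ and extends continuously to $\overline D(0,\rho)$ (the extension is again denoted $g$). For $M\ge N$ put \[ \mathcal C(\mathbf c;z^M;N,\rho)=\sum_{j=0}^{N-1}\binom Mj^2\binom{M-j-1}{N-j-1}^2\frac{\rho^{M-j}}{c_j}, \qquad S=\sum_{M\ge N:\,c_M>0}c_M\,\mathcal C(\mathbf c;z^M;N,\rho)\in[0,\infty]. \] (1) For all $A\in\mathcal P_N(\overline D(0,\rho))$ and all real $t\ge S$, \[ t\sum_{j=0}^{N-1}c_jA^{\circ j}-g[A]\in\mathcal P_N(\mathbb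 C). \] (2) Let $g_+(z)=\sum_{M\ge N:\,c_M>0}c_Mz^M$ and $g_2(z)=g_+(z^2)$. The limit $D=\lim_{x\to\sqrt\rho^-}g_2^{(2N-2)}(x)$, over real $x<\sqrt\rho$, exists in $[0,\infty]$, and \[ S\le\frac{D}{2^{N-1}\,(N-1)!^2}\sum_{j=0}^{N-1}\binom{N-1}{j}^2\frac{\rho^{N-j-1}}{c_j}. \] In particular, the series $S$ converges whenever $D<\infty$. (3) If the power series of $g_+$ has radius of convergence greater than $\rho$, then the series $S$ converges and the bound in (2) holds with $D=g_2^{(2N-2)}(\sqrt\rho)$, the derivative at the point $\sqrt\rho$ itself. -/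

import Mathlib

open Set Filter Topology
open scoped ENNReal ComplexOrder Nat

noncomputable section

/-- The set of positive semidefinite (Hermitian) `N × N` complex matrices with entries in `K`. -/
def psdMatrices (N : ℕ) (K : Set ℂ) : Set (Matrix (Fin N) (Fin N) ℂ) :=
  {A | A.PosSemidef ∧ ∀ i j, A i j ∈ K}

/-- The Hadamard (entrywise) power of a matrix; the zeroth power is the all-ones matrix. -/
def hadamardPow {N : ℕ} (A : Matrix (Fin N) (Fin N) ℂ) (k : ℕ) : Matrix (Fin N) (Fin N) ℂ :=
  A.map fun z => z ^ k

/-- The constant attached to the coefficients `d 0, …, d (N - 1)`, the monomial `z ^ M` with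
`N ≤ M`, the dimension `N` and the radius `ρ`. For `j < N ≤ M` the natural-number subtractions
below are genuine ones. -/
def thresholdConst (d : ℕ → ℝ) (M N : ℕ) (ρ : ℝ) : ℝ :=
  ∑ j ∈ Finset.range N,
    (M.choose j : ℝ) ^ 2 * ((M - j - 1).choose (N - j - 1) : ℝ) ^ 2 * (ρ ^ (M - j) / d j)

/-- The `M`-th term of the series `∑_{M ≥ N, c_M > 0} c_M 𝒞(c; z ^ M; N, ρ)`. -/
def thresholdTerm (c : ℕ → ℝ) (N : ℕ) (ρ : ℝ) (M : ℕ) : ℝ :=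
  if N ≤ M ∧ 0 < c M then c M * thresholdConst c M N ρ else 0

/-- The `M`-th term of the power series `g₊(x) = ∑_{M ≥ N, c_M > 0} c_M x ^ M`. -/
def gPlusTerm (c : ℕ → ℝ) (N : ℕ) (x : ℝ) (M : ℕ) : ℝ :=
  if N ≤ M ∧ 0 < c M then c M * x ^ M else 0

/-- The function `g₊`, restricted to the real axis (its coefficients are real). -/
def gPlus (c : ℕ → ℝ) (N : ℕ) (x : ℝ) : ℝ := ∑' M, gPlusTerm c N x M

/-- The function `g₂(x) = g₊(x ^ 2)`, restricted to the real axis. -/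
def gTwo (c : ℕ → ℝ) (N : ℕ) (x : ℝ) : ℝ := gPlus c N (x ^ 2)

/-- The explicit bound, as a function of the value `D` of the `(2N-2)`-th derivative of `g₂`
at `√ρ`. -/
def analyticBound (c : ℕ → ℝ) (N : ℕ) (ρ D : ℝ) : ℝ :=
  D / (2 ^ (N - 1) * ((N - 1)! : ℝ) ^ 2) *
    ∑ j ∈ Finset.range N, ((N - 1).choose j : ℝ) ^ 2 * (ρ ^ (N - j - 1) / c j)

end

/-! The heart is the case of one monomial `z ^ M`. If `A = u u*`, the quadratic form of the `k`-th
entrywise power is `|∑ x_i u_i ^ k| ^ 2` up to conjugating `x`. Reducing `X ^ M` modulo `∏ (X -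
u_i)` writes `u_i ^ M` as a combination of lower powers with explicitly bounded coefficients, and a
weighted Cauchy–Schwarz inequality turns these bounds into `thresholdConst` (`norm_sq_sum_pow_le`).

A general `A` is reached by induction on `N`, in the manner of FitzGerald and Horn. Split off a rank
one `B` agreeing with `A` in row and column `0`. Along the segment from `B` to `A`, the derivative
of `f[·]` is `(A - B) ∘ f'[·]`, which lives on the other `N - 1` indices. There `f'` is a multiple
of a polynomial of the same type, and the constants are compatible (`succ_mul_thresholdConst_le`),
so the Schur product theorem applies.

Summing over `M` gives part (1): negative coefficients only help, and the boundary of the disc is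
reached through `s • A` with `s → 1`. Parts (2) and (3) compare `thresholdConst` with the
`(2N-2)`-th derivative of `x ^ (2M)` at `√ρ` for each `M`; nonnegativity of the coefficients permits
termwise differentiation and passage to the endpoint. -/

/-! ### Remainders of monomials and their coefficients -/

open Polynomial in
/-- The remainder of `X ^ M` modulo `∏ i < N, (X - u i)`, by a recursion on both indices. -/
noncomputable def powRemainder (u : ℕ → ℂ) : ℕ → ℕ → Polynomial ℂ
  | 0, _ => 0
  | _ + 1, 0 => 1
  | N + 1, M + 1 =>
    C (u N) * powRemainder u (N + 1) M + (X - C (u N)) * powRemainder u N M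

open Polynomial in
theorem powRemainder_coeff_zero_succ (u : ℕ → ℂ) (N M : ℕ) :
    (powRemainder u (N + 1) (M + 1)).coeff 0 =
      u N * (powRemainder u (N + 1) M).coeff 0 - u N * (powRemainder u N M).coeff 0 := by
  rw [powRemainder]
  simp [sub_mul, mul_coeff_zero]
  ring

open Polynomial in
theorem powRemainder_coeff_succ_succ (u : ℕ → ℂ) (N M j : ℕ) :
    (powRemainder u (N + 1) (M + 1)).coeff (j + 1) =
      u N * (powRemainder u (N + 1) M).coeff (j + 1) +
        (powRemainder u N M).coeff j - u N * (powRemainder u N M).coeff (j + 1) := by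
  rw [powRemainder]
  simp [sub_mul, coeff_X_mul, coeff_C_mul]
  ring

theorem powRemainder_coeff_eq_zero (u : ℕ → ℂ) :
    ∀ N M j : ℕ, N ≤ j → (powRemainder u N M).coeff j = 0
  | 0, _, _, _ => by simp [powRemainder]
  | N + 1, 0, j, h => by
    rw [powRemainder, Polynomial.coeff_one, if_neg (by omega)]
  | N + 1, M + 1, 0, h => by omega
  | N + 1, M + 1, j + 1, h => by
    rw [powRemainder_coeff_succ_succ, powRemainder_coeff_eq_zero u (N + 1) M (j + 1) h,
      powRemainder_coeff_eq_zero u N M j (by omega),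
      powRemainder_coeff_eq_zero u N M (j + 1) (by omega)]
    simp

theorem powRemainder_eval (u : ℕ → ℂ) :
    ∀ N M i : ℕ, i < N → (powRemainder u N M).eval (u i) = u i ^ M
  | 0, _, _, h => by omega
  | N + 1, 0, i, h => by simp [powRemainder]
  | N + 1, M + 1, i, h => by
    rw [powRemainder]
    simp only [Polynomial.eval_add, Polynomial.eval_mul, Polynomial.eval_C, Polynomial.eval_sub,
      Polynomial.eval_X, powRemainder_eval u (N + 1) M i h]
    rcases Nat.lt_succ_iff_lt_or_eq.1 h with h' | rfl
    · rw [powRemainder_eval u N M i h']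
      ring
    · ring

theorem powRemainder_of_lt (u : ℕ → ℂ) :
    ∀ N M : ℕ, M < N → powRemainder u N M = Polynomial.X ^ M
  | 0, _, h => by omega
  | N + 1, 0, h => by simp [powRemainder]
  | N + 1, M + 1, h => by
    rw [powRemainder, powRemainder_of_lt u (N + 1) M (by omega),
      powRemainder_of_lt u N M (by omega)]
    ring

theorem powRemainder_sum_eq (u : ℕ → ℂ) (N M i : ℕ) (hi : i < N) :
    ∑ j ∈ Finset.range N, (powRemainder u N M).coeff j * u i ^ j = u i ^ M := by
  rw [← powRemainder_eval u N M i hi, Polynomial.eval_eq_sum_range' (n := N)]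
  have : (powRemainder u N M).degree < N := by
    rw [Polynomial.degree_lt_iff_coeff_zero]
    exact fun m hm => powRemainder_coeff_eq_zero u N M m hm
  by_cases h0 : powRemainder u N M = 0
  · rw [h0]; simp; omega
  · exact (Polynomial.natDegree_lt_iff_degree_lt h0).2 this

/-- The triangle inequality in the recursion loses nothing when all `u i = r`, since the terms then
have equal signs. The induction therefore closes with equalities of binomials. -/
theorem norm_powRemainder_coeff_le (u : ℕ → ℂ) (r : ℝ) (hu : ∀ i, ‖u i‖ ≤ r) :
    ∀ N M j : ℕ, j < N → N ≤ M → ‖(powRemainder u N M).coeff j‖ ≤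
      ((M.choose j * (M - j - 1).choose (N - j - 1) : ℕ) : ℝ) * r ^ (M - j) := by
  have hr : 0 ≤ r := (norm_nonneg _).trans (hu 0)
  intro N M
  induction M generalizing N with
  | zero => intro j h1 h2; omega
  | succ M ih =>
    intro j hj hM
    obtain _ | N := N
    · omega
    have hM' : N ≤ M := by omega
    have key : ∀ z : ℂ, ∀ (i : ℕ) (b : ℝ), ‖z‖ ≤ b → ‖u i * z‖ ≤ r * b := fun z i b h => by
      rw [norm_mul]; exact mul_le_mul (hu i) h (norm_nonneg _) hr
    -- the leading remainder, including the case `M = N`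
    have h1 : ‖(powRemainder u (N + 1) M).coeff j‖ ≤
        (if N = M then (if j = N then 1 else 0)
          else ((M.choose j * (M - j - 1).choose (N - j) : ℕ) : ℝ) * r ^ (M - j)) := by
      split_ifs with h h'
      · subst h
        rw [powRemainder_of_lt u (N + 1) N (by omega), Polynomial.coeff_X_pow, if_pos h']
        simp
      · subst h
        rw [powRemainder_of_lt u (N + 1) N (by omega), Polynomial.coeff_X_pow, if_neg h']
        simp
      · have := ih (N + 1) j hj (by omega)
        rwa [show N + 1 - j - 1 = N - j by omega] at this
    have h3 : ‖(powRemainder u N M).coeff j‖ ≤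
        (if j < N then ((M.choose j * (M - j - 1).choose (N - j - 1) : ℕ) : ℝ) * r ^ (M - j)
          else 0) := by
      split_ifs with h
      · exact ih N j h hM'
      · rw [powRemainder_coeff_eq_zero u N M j (by omega)]; simp
    -- Pascal's rule in the second binomial. The term shifted by `X` later supplies Pascal's rule in
    -- the first.
    have h13 : r * (if N = M then (if j = N then 1 else 0)
          else ((M.choose j * (M - j - 1).choose (N - j) : ℕ) : ℝ) * r ^ (M - j)) +
        r * (if j < N then ((M.choose j * (M - j - 1).choose (N - j - 1) : ℕ) : ℝ) * r ^ (M - j)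
          else 0) = ((M.choose j * (M - j).choose (N - j) : ℕ) : ℝ) * r ^ (M + 1 - j) := by
      rw [show M + 1 - j = (M - j) + 1 by omega, pow_succ]
      rcases Nat.lt_succ_iff_lt_or_eq.1 hj with h | rfl
      · rw [if_pos h]
        obtain ⟨n, rfl⟩ : ∃ n, N = j + n + 1 := ⟨N - j - 1, by omega⟩
        obtain ⟨m, rfl⟩ : ∃ m, M = j + n + 1 + m := ⟨M - (j + n + 1), by omega⟩
        rw [show j + n + 1 + m - j = (n + m) + 1 by omega, show j + n + 1 - j = n + 1 by omega]
        simp only [Nat.add_sub_cancel]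
        rw [Nat.choose_succ_succ]
        split_ifs with h1 h2
        · omega
        · have : m = 0 := by omega
          subst this
          simp
          ring
        · push_cast
          ring
      · rw [if_neg (lt_irrefl j)]
        by_cases h1 : j = M
        · subst h1; simp
        · simp only [if_neg h1, Nat.sub_self, Nat.choose_zero_right]
          ring
    obtain _ | j := j
    · rw [powRemainder_coeff_zero_succ]
      refine (norm_sub_le _ _).trans ((add_le_add (key _ N _ h1) (key _ N _ h3)).trans
        (h13.le.trans ?_))
      simp
    · rw [powRemainder_coeff_succ_succ]
      have h2 := ih N j (by omega) hM'
      rw [add_sub_right_comm]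
      refine (norm_add_le _ _).trans ((add_le_add ((norm_sub_le _ _).trans
        (add_le_add (key _ N _ h1) (key _ N _ h3))) h2).trans ?_)
      rw [h13]
      have e1 : M + 1 - (j + 1) - 1 = M - j - 1 := by omega
      have e2 : N + 1 - (j + 1) - 1 = N - j - 1 := by omega
      have e3 : M + 1 - (j + 1) = M - j := by omega
      have e4 : M - (j + 1) = M - j - 1 := by omega
      have e5 : N - (j + 1) = N - j - 1 := by omega
      rw [e1, e2, e3, e4, e5, Nat.choose_succ_succ]
      push_cast
      apply le_of_eq
      ring

/-! ### The rank one inequality -/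

/-- The quadratic form of `(u u*) ^ M` (entrywise power) is dominated by those of the lower powers. -/
theorem norm_sq_sum_pow_le (N M : ℕ) (hM : N ≤ M) (c : ℕ → ℝ) (hc : ∀ j, j < N → 0 < c j)
    (ρ : ℝ) (hρ : 0 ≤ ρ) (u : Fin N → ℂ) (hu : ∀ i, ‖u i‖ ^ 2 ≤ ρ) (x : Fin N → ℂ) :
    ‖∑ i, x i * u i ^ M‖ ^ 2 ≤
      thresholdConst c M N ρ * ∑ j ∈ Finset.range N, c j * ‖∑ i, x i * u i ^ j‖ ^ 2 := by
  set v : ℕ → ℂ := fun i => if h : i < N then u ⟨i, h⟩ else 0 with hv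
  have hvu : ∀ i : Fin N, v i = u i := fun i => by simp [hv]
  have hvn : ∀ i, ‖v i‖ ≤ √ρ := fun i => by
    by_cases h : i < N
    · simp only [hv, h, dite_true]
      exact Real.le_sqrt_of_sq_le (hu _)
    · simp only [hv, h, dite_false, norm_zero]
      exact Real.sqrt_nonneg _
  set α : ℕ → ℂ := fun j => (powRemainder v N M).coeff j
  have h1 : ∑ i, x i * u i ^ M = ∑ j ∈ Finset.range N, α j * ∑ i, x i * u i ^ j := by
    simp only [Finset.mul_sum]
    rw [Finset.sum_comm]
    refine Finset.sum_congr rfl fun i _ => ?_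
    rw [← hvu, ← powRemainder_sum_eq v N M i i.2, Finset.mul_sum]
    exact Finset.sum_congr rfl fun j _ => by ring
  have h2 : ‖∑ i, x i * u i ^ M‖ ≤ ∑ j ∈ Finset.range N, ‖α j‖ * ‖∑ i, x i * u i ^ j‖ := by
    rw [h1]
    exact (norm_sum_le _ _).trans (le_of_eq (by simp))
  -- Cauchy–Schwarz with weights `c j`, the origin of the denominators in `thresholdConst`.
  have h3 : (∑ j ∈ Finset.range N, ‖α j‖ * ‖∑ i, x i * u i ^ j‖) ^ 2 ≤
      (∑ j ∈ Finset.range N, ‖α j‖ ^ 2 / c j) *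
        ∑ j ∈ Finset.range N, c j * ‖∑ i, x i * u i ^ j‖ ^ 2 := by
    apply Finset.sum_sq_le_sum_mul_sum_of_sq_le_mul
    · intro j hj
      exact div_nonneg (sq_nonneg _) (hc j (Finset.mem_range.1 hj)).le
    · intro j hj
      exact mul_nonneg (hc j (Finset.mem_range.1 hj)).le (sq_nonneg _)
    · intro j hj
      have := (hc j (Finset.mem_range.1 hj)).ne'
      exact le_of_eq (by field_simp)
  refine (pow_le_pow_left₀ (norm_nonneg _) h2 2).trans (h3.trans ?_)
  refine mul_le_mul_of_nonneg_right ?_ (Finset.sum_nonneg fun j hj =>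
    mul_nonneg (hc j (Finset.mem_range.1 hj)).le (sq_nonneg _))
  refine Finset.sum_le_sum fun j hj => ?_
  have hj := Finset.mem_range.1 hj
  rw [← mul_div_assoc]
  refine div_le_div_of_nonneg_right ?_ (hc j hj).le
  have := pow_le_pow_left₀ (norm_nonneg _) (norm_powRemainder_coeff_le v _ hvn N M j hj hM) 2
  refine this.trans (le_of_eq ?_)
  rw [mul_pow, ← pow_mul, mul_comm (M - j) 2, pow_mul, Real.sq_sqrt hρ]
  push_cast
  ring

/-! ### Positive semidefinite matrices and rank one splitting -/

open Matrix in
theorem posSemidef_iff_re_sum_nonneg {n : Type*} [Fintype n] (A : Matrix n n ℂ) :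
    A.PosSemidef ↔ A.IsHermitian ∧
      ∀ x : n → ℂ, 0 ≤ (∑ i, ∑ j, star (x i) * A i j * x j).re := by
  have key : ∀ x : n → ℂ, star x ⬝ᵥ A *ᵥ x = ∑ i, ∑ j, star (x i) * A i j * x j := fun x => by
    simp only [dotProduct, mulVec, Finset.mul_sum, Pi.star_apply, mul_assoc]
  rw [posSemidef_iff_dotProduct_mulVec]
  refine and_congr_right fun hA => forall_congr' fun x => ?_
  rw [← key, Complex.nonneg_iff]
  have : (star x ⬝ᵥ A *ᵥ x).im = 0 := hA.im_star_dotProduct_mulVec_self x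
  simp [this]

/-- Nonnegativity of a principal `2 × 2` minor; it will show that a zero diagonal entry kills its
column. -/
theorem norm_sq_apply_le_of_posSemidef {n : Type*} [Fintype n] {A : Matrix n n ℂ}
    (hA : A.PosSemidef) (i j : n) : ‖A i j‖ ^ 2 ≤ (A i i).re * (A j j).re := by
  have h := (hA.submatrix ![i, j]).det_nonneg
  rw [Matrix.det_fin_two] at h
  simp only [Matrix.submatrix_apply, Matrix.cons_val_zero, Matrix.cons_val_one] at h
  have hi := Complex.nonneg_iff.1 (hA.diag_nonneg (i := i))
  have hj := Complex.nonneg_iff.1 (hA.diag_nonneg (i := j))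
  rw [← hA.isHermitian.apply j i] at h
  have h2 := (Complex.nonneg_iff.1 h).1
  rw [Complex.star_def, Complex.mul_conj, Complex.sub_re, Complex.mul_re, ← hi.2, ← hj.2,
    Complex.ofReal_re, Complex.normSq_eq_norm_sq] at h2
  linarith

/-- Splitting off a rank one matrix which agrees with `A` in the row and column `k`. -/
theorem exists_rankOne_of_posSemidef {n : Type*} [Fintype n] [DecidableEq n] {A : Matrix n n ℂ}
    (hA : A.PosSemidef) (k : n) :
    ∃ u : n → ℂ, (A - Matrix.vecMulVec u (star u)).PosSemidef ∧
      (∀ i, A i k = u i * star (u k)) ∧ ∀ i, A k i = u k * star (u i) := by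
  obtain ⟨ha, hb⟩ := Complex.nonneg_iff.1 (hA.diag_nonneg (i := k))
  set a : ℝ := (A k k).re with ha_def
  have hkk : A k k = (a : ℂ) := Complex.ext rfl (by simpa using hb.symm)
  have hsq : ((√a : ℝ) : ℂ) * ((√a : ℝ) : ℂ) = (a : ℂ) := by
    rw [← Complex.ofReal_mul, Real.mul_self_sqrt ha]
  have hherm : ∀ i j, star (A i j) = A j i := fun i j => hA.isHermitian.apply j i
  -- If `a = 0`, division by zero makes `u = 0`, the right choice because column `k` then vanishes.
  set u : n → ℂ := fun i => A i k / ((√a : ℝ) : ℂ) with hu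
  have huu : ∀ i j, u i * star (u j) = A i k * A k j / (a : ℂ) := fun i j => by
    simp only [hu, star_div₀, hherm]
    rw [Complex.star_def, Complex.conj_ofReal, div_mul_div_comm, hsq]
  have hz : a = 0 → ∀ i, A i k = 0 := fun h0 i => by
    have := norm_sq_apply_le_of_posSemidef hA i k
    rw [← ha_def, h0, mul_zero] at this
    exact norm_eq_zero.1 (pow_eq_zero_iff two_ne_zero |>.1 (le_antisymm this (sq_nonneg _)))
  have hcol : ∀ i, A i k = u i * star (u k) := fun i => by
    rw [huu, hkk]
    by_cases h0 : a = 0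
    · simp [hz h0 i]
    · have : (a : ℂ) ≠ 0 := by exact_mod_cast h0
      field_simp
  have hrow : ∀ i, A k i = u k * star (u i) := fun i => by
    rw [← hherm, hcol, star_mul', star_star, mul_comm]
  refine ⟨u, ?_, hcol, hrow⟩
  -- The Schur complement as a congruence: `A * P = A - u u*`, and `Pᴴ` fixes this matrix because
  -- its row `k` is zero.
  set P : Matrix n n ℂ := 1 - Matrix.of fun i j => if i = k then A k j / (a : ℂ) else 0 with hP
  have hAP : A * P = A - Matrix.vecMulVec u (star u) := by
    ext i j
    rw [hP, Matrix.mul_sub, Matrix.mul_one, Matrix.sub_apply, Matrix.sub_apply, Matrix.mul_apply,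
      Matrix.vecMulVec_apply, Pi.star_apply, huu]
    simp [mul_div_assoc]
  have hPAP : P.conjTranspose * A * P = A - Matrix.vecMulVec u (star u) := by
    rw [Matrix.mul_assoc, hAP, hP, Matrix.conjTranspose_sub, Matrix.conjTranspose_one,
      Matrix.sub_mul, Matrix.one_mul, sub_eq_self]
    ext i j
    rw [Matrix.mul_apply, Matrix.zero_apply]
    refine Finset.sum_eq_zero fun l _ => ?_
    by_cases hl : l = k
    · subst hl
      simp [Matrix.vecMulVec_apply, hrow j]
    · simp [Matrix.conjTranspose_apply, hl]
  rw [← hPAP]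
  exact hA.conjTranspose_mul_mul_same P

/-! ### A single monomial: induction on the dimension -/

/-- The polynomial `t ∑_{j < N} d_j z ^ j - z ^ M`. -/
noncomputable def thresholdPoly (d : ℕ → ℝ) (N M : ℕ) (t : ℝ) (z : ℂ) : ℂ :=
  (t : ℂ) * ∑ j ∈ Finset.range N, (d j : ℂ) * z ^ j - z ^ M

theorem thresholdPoly_star (d : ℕ → ℝ) (N M : ℕ) (t : ℝ) (z : ℂ) :
    star (thresholdPoly d N M t z) = thresholdPoly d N M t (star z) := by
  simp [thresholdPoly]

theorem isHermitian_map_thresholdPoly {n : Type*} (d : ℕ → ℝ) (N M : ℕ) (t : ℝ)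
    {A : Matrix n n ℂ} (hA : A.IsHermitian) : (A.map (thresholdPoly d N M t)).IsHermitian := by
  ext i j
  simp only [Matrix.conjTranspose_apply, Matrix.map_apply, thresholdPoly_star, hA.apply]

/-- The family is stable under differentiation up to a positive factor, which is what makes an
induction on `N` possible. -/
theorem hasDerivAt_thresholdPoly (d : ℕ → ℝ) (N M : ℕ) (t : ℝ) (z : ℂ) :
    HasDerivAt (thresholdPoly d (N + 1) (M + 1) t)
      (((M + 1 : ℕ) : ℂ) *
        thresholdPoly (fun j => ((j + 1 : ℕ) : ℝ) * d (j + 1)) N M (t / ((M + 1 : ℕ) : ℝ)) z) z := by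
  have h1 : HasDerivAt (thresholdPoly d (N + 1) (M + 1) t)
      ((t : ℂ) * ∑ j ∈ Finset.range (N + 1), (d j : ℂ) * ((j : ℂ) * z ^ (j - 1)) -
        ((M + 1 : ℕ) : ℂ) * z ^ (M + 1 - 1)) z := by
    unfold thresholdPoly
    refine HasDerivAt.sub (HasDerivAt.const_mul _ ?_) (hasDerivAt_pow _ _)
    exact HasDerivAt.fun_sum fun j _ => HasDerivAt.const_mul _ (hasDerivAt_pow _ _)
  convert h1 using 1
  have hM : ((M + 1 : ℕ) : ℂ) ≠ 0 := by exact_mod_cast Nat.succ_ne_zero M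
  rw [thresholdPoly, Finset.sum_range_succ', mul_sub, ← mul_assoc, Complex.ofReal_div,
    Complex.ofReal_natCast, mul_div_cancel₀ _ hM]
  simp only [Nat.add_sub_cancel, Nat.cast_zero, zero_mul, mul_zero, add_zero]
  congr 2
  refine Finset.sum_congr rfl fun j _ => ?_
  push_cast
  ring

/-- A threshold adequate for the polynomial is adequate for its derivative. Term `j` on the left is
compared with term `j + 1` on the right via `(M+1) C(M,j) = (j+1) C(M+1,j+1)` and `C(M,j) ≤
C(M+1,j+1)`; term `0` on the right is discarded. -/
theorem succ_mul_thresholdConst_le (d : ℕ → ℝ) (N M : ℕ) (hd : ∀ j, j < N + 1 → 0 < d j)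
    (ρ : ℝ) (hρ : 0 ≤ ρ) (hM : N ≤ M) :
    ((M + 1 : ℕ) : ℝ) * thresholdConst (fun j => ((j + 1 : ℕ) : ℝ) * d (j + 1)) M N ρ ≤
      thresholdConst d (M + 1) (N + 1) ρ := by
  rw [thresholdConst, thresholdConst, Finset.sum_range_succ', Finset.mul_sum]
  refine (Finset.sum_le_sum fun j hj => ?_).trans (le_add_of_nonneg_right ?_)
  · have hj := Finset.mem_range.1 hj
    have hdj := hd (j + 1) (by omega)
    rw [show M + 1 - (j + 1) = M - j by omega, show N + 1 - (j + 1) - 1 = N - j - 1 by omega]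
    set q : ℝ := ((M - j - 1).choose (N - j - 1) : ℝ) ^ 2 * (ρ ^ (M - j) / d (j + 1)) with hq
    have hq0 : 0 ≤ q := mul_nonneg (sq_nonneg _) (div_nonneg (pow_nonneg hρ _) hdj.le)
    have e1 : ((M + 1 : ℕ) : ℝ) * ((M.choose j : ℝ) ^ 2 * ((M - j - 1).choose (N - j - 1) : ℝ) ^ 2 *
        (ρ ^ (M - j) / (((j + 1 : ℕ) : ℝ) * d (j + 1)))) =
        ((M + 1 : ℕ) : ℝ) * (M.choose j : ℝ) ^ 2 / ((j + 1 : ℕ) : ℝ) * q := by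
      rw [hq]
      have : ((j + 1 : ℕ) : ℝ) ≠ 0 := by exact_mod_cast Nat.succ_ne_zero j
      field_simp
    rw [e1, mul_assoc _ _ (ρ ^ (M - j) / d (j + 1)), ← hq]
    refine mul_le_mul_of_nonneg_right ?_ hq0
    have hpas : ((M + 1 : ℕ) : ℝ) * (M.choose j : ℝ) =
        ((M + 1).choose (j + 1) : ℝ) * ((j + 1 : ℕ) : ℝ) := by
      exact_mod_cast Nat.add_one_mul_choose_eq M j
    have hle : (M.choose j : ℝ) ≤ ((M + 1).choose (j + 1) : ℝ) := by
      rw [Nat.choose_succ_succ]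
      push_cast
      exact le_add_of_nonneg_right (Nat.cast_nonneg _)
    have hj1 : (0 : ℝ) < ((j + 1 : ℕ) : ℝ) := by exact_mod_cast Nat.succ_pos j
    rw [div_le_iff₀ hj1, sq, ← mul_assoc, hpas, sq]
    nlinarith [mul_le_mul_of_nonneg_left hle
      (mul_nonneg (Nat.cast_nonneg ((M + 1).choose (j + 1)) : (0 : ℝ) ≤ _) hj1.le)]
  · exact mul_nonneg (mul_nonneg (sq_nonneg _) (sq_nonneg _))
      (div_nonneg (pow_nonneg hρ _) (hd 0 (by omega)).le)

theorem posSemidef_map_thresholdPoly_rankOne (d : ℕ → ℝ) (N M : ℕ) (hM : N ≤ M)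
    (hd : ∀ j, j < N → 0 < d j) (ρ : ℝ) (hρ : 0 ≤ ρ) (t : ℝ) (ht : thresholdConst d M N ρ ≤ t)
    (u : Fin N → ℂ) (hu : ∀ i, ‖u i‖ ^ 2 ≤ ρ) :
    ((Matrix.vecMulVec u (star u)).map (thresholdPoly d N M t)).PosSemidef := by
  rw [posSemidef_iff_re_sum_nonneg]
  refine ⟨isHermitian_map_thresholdPoly _ _ _ _ (Matrix.posSemidef_vecMulVec_self_star u).1,
    fun x => ?_⟩
  have hpow : ∀ k : ℕ, ∑ i, ∑ j, star (x i) * (u i * star (u j)) ^ k * x j =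
      ((‖∑ i, star (x i) * u i ^ k‖ ^ 2 : ℝ) : ℂ) := fun k => by
    rw [← Complex.normSq_eq_norm_sq, ← Complex.mul_conj, map_sum, Finset.sum_mul_sum]
    refine Finset.sum_congr rfl fun i _ => Finset.sum_congr rfl fun j _ => ?_
    simp
    ring
  have hsum : ∑ i, ∑ j, star (x i) *
        (Matrix.vecMulVec u (star u)).map (thresholdPoly d N M t) i j * x j =
      ((t * (∑ k ∈ Finset.range N, d k * ‖∑ i, star (x i) * u i ^ k‖ ^ 2) -
        ‖∑ i, star (x i) * u i ^ M‖ ^ 2 : ℝ) : ℂ) := by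
    push_cast
    have h := hpow M
    push_cast at h
    rw [← h]
    have h' : ∑ k ∈ Finset.range N, (d k : ℂ) * ((‖∑ i, star (x i) * u i ^ k‖ : ℝ) : ℂ) ^ 2 =
        ∑ k ∈ Finset.range N, (d k : ℂ) * ∑ i, ∑ j, star (x i) * (u i * star (u j)) ^ k * x j :=
      Finset.sum_congr rfl fun k _ => by rw [hpow k]; push_cast; rfl
    rw [h']
    simp only [Finset.mul_sum]
    rw [Finset.sum_comm (s := Finset.range N), ← Finset.sum_sub_distrib]
    refine Finset.sum_congr rfl fun i _ => ?_
    rw [Finset.sum_comm (s := Finset.range N), ← Finset.sum_sub_distrib]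
    refine Finset.sum_congr rfl fun j _ => ?_
    rw [Matrix.map_apply, thresholdPoly, Matrix.vecMulVec_apply, Pi.star_apply, mul_sub, sub_mul,
      Finset.mul_sum, Finset.mul_sum, Finset.sum_mul]
    congr 1
    exact Finset.sum_congr rfl fun k _ => by ring
  rw [hsum, Complex.ofReal_re, sub_nonneg]
  refine (norm_sq_sum_pow_le N M hM d hd ρ hρ u hu fun i => star (x i)).trans ?_
  exact mul_le_mul_of_nonneg_right ht (Finset.sum_nonneg fun j hj =>
    mul_nonneg (hd j (Finset.mem_range.1 hj)).le (sq_nonneg _))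

/-- If `A - B` vanishes in the row and column `0`, then the increment of a function along the
segment from `B` to `A` is governed by its derivative on the remaining indices. -/
theorem re_sum_map_le_of_deriv {N : ℕ} {f f' : ℂ → ℂ} (hf : ∀ z, HasDerivAt f (f' z) z)
    {A B : Matrix (Fin (N + 1)) (Fin (N + 1)) ℂ} (hAB : (A - B).PosSemidef)
    (hcol : ∀ i, A i 0 = B i 0) (hrow : ∀ i, A 0 i = B 0 i)
    (hf' : ∀ s : ℝ, 0 ≤ s → s ≤ 1 →
      (((B + (s : ℂ) • (A - B)).submatrix Fin.succ Fin.succ).map f').PosSemidef)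
    (x : Fin (N + 1) → ℂ) :
    (∑ i, ∑ j, star (x i) * f (B i j) * x j).re ≤
      (∑ i, ∑ j, star (x i) * f (A i j) * x j).re := by
  set X : ℝ → Fin (N + 1) → Fin (N + 1) → ℂ := fun s i j => B i j + (s : ℂ) * (A i j - B i j)
  set q : ℝ → ℝ := fun s => (∑ i, ∑ j, star (x i) * f (X s i j) * x j).re
  have hder : ∀ s : ℝ, HasDerivAt q
      (∑ i, ∑ j, star (x i) * (f' (X s i j) * (A i j - B i j)) * x j).re s := fun s => by
    have hX : ∀ i j, HasDerivAt (fun s : ℝ => X s i j) (A i j - B i j) s := fun i j => by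
      have := (((hasDerivAt_id s).ofReal_comp).mul_const (A i j - B i j)).const_add (B i j)
      rw [Complex.ofReal_one, one_mul] at this
      exact this
    have h1 : HasDerivAt (fun s : ℝ => ∑ i, ∑ j, star (x i) * f (X s i j) * x j)
        (∑ i, ∑ j, star (x i) * (f' (X s i j) * (A i j - B i j)) * x j) s := by
      refine HasDerivAt.fun_sum fun i _ => HasDerivAt.fun_sum fun j _ => ?_
      exact (((hf (X s i j)).comp s (hX i j)).const_mul _).mul_const _
    exact Complex.reCLM.hasFDerivAt.comp_hasDerivAt s h1
  -- Row and column `0` of `A - B` vanish, so only the remaining block contributes; there the Schur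
  -- product theorem applies.
  have hnonneg : ∀ s : ℝ, 0 ≤ s → s ≤ 1 →
      0 ≤ (∑ i, ∑ j, star (x i) * (f' (X s i j) * (A i j - B i j)) * x j).re := by
    intro s h0 h1
    have hs := ((hf' s h0 h1).hadamard (hAB.submatrix Fin.succ))
    have := ((posSemidef_iff_re_sum_nonneg _).1 hs).2 (fun i => x i.succ)
    rw [Fin.sum_univ_succ]
    simp only [Fin.sum_univ_succ (n := N), hcol, hrow, sub_self, mul_zero, zero_mul, zero_add,
      Finset.sum_const_zero]
    simpa [X] using this
  have hmono : MonotoneOn q (Icc 0 1) := by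
    refine monotoneOn_of_deriv_nonneg (convex_Icc 0 1)
      (fun s _ => (hder s).continuousAt.continuousWithinAt)
      (fun s _ => (hder s).differentiableAt.differentiableWithinAt) fun s hs => ?_
    rw [interior_Icc] at hs
    rw [(hder s).deriv]
    exact hnonneg s hs.1.le hs.2.le
  have := hmono (left_mem_Icc.2 zero_le_one) (right_mem_Icc.2 zero_le_one) zero_le_one
  simpa [q, X] using this

theorem posSemidef_map_thresholdPoly (ρ : ℝ) (hρ : 0 ≤ ρ) (N M : ℕ) (hM : N ≤ M) (d : ℕ → ℝ)
    (hd : ∀ j, j < N → 0 < d j) (t : ℝ) (ht : thresholdConst d M N ρ ≤ t)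
    (A : Matrix (Fin N) (Fin N) ℂ) (hA : A.PosSemidef) (hAρ : ∀ i j, ‖A i j‖ ≤ ρ) :
    (A.map (thresholdPoly d N M t)).PosSemidef := by
  induction N generalizing M d t with
  | zero =>
    rw [show A.map (thresholdPoly d 0 M t) = 0 from Subsingleton.elim _ _]
    exact Matrix.PosSemidef.zero
  | succ N ih =>
    obtain _ | M := M
    · omega
    obtain ⟨u, hu, hcol, hrow⟩ := exists_rankOne_of_posSemidef hA 0
    set B := Matrix.vecMulVec u (star u) with hB
    have hBapp : ∀ i j, B i j = u i * star (u j) := fun i j => Matrix.vecMulVec_apply _ _ _ _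
    -- The diagonal of `A - B` is nonnegative, so `‖u i‖ ^ 2` is at most `A i i`.
    have huρ : ∀ i, ‖u i‖ ^ 2 ≤ ρ := fun i => by
      have h1 := (Complex.nonneg_iff.1 (hu.diag_nonneg (i := i))).1
      rw [Matrix.sub_apply, Complex.sub_re, hBapp, Complex.star_def, Complex.mul_conj,
        Complex.ofReal_re, Complex.normSq_eq_norm_sq] at h1
      linarith [(Complex.re_le_norm (A i i)).trans (hAρ i i)]
    have hBρ : ∀ i j, ‖B i j‖ ≤ ρ := fun i j => by
      rw [hBapp, norm_mul, norm_star]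
      nlinarith [huρ i, huρ j, sq_nonneg (‖u i‖ - ‖u j‖)]
    have hBpsd : B.PosSemidef := Matrix.posSemidef_vecMulVec_self_star u
    have hrank := posSemidef_map_thresholdPoly_rankOne d (N + 1) (M + 1) hM hd ρ hρ t ht u huρ
    rw [posSemidef_iff_re_sum_nonneg] at hrank ⊢
    refine ⟨isHermitian_map_thresholdPoly _ _ _ _ hA.1, fun x => (hrank.2 x).trans ?_⟩
    refine re_sum_map_le_of_deriv (hasDerivAt_thresholdPoly d N M t) hu
      (fun i => by rw [hcol, hBapp]) (fun i => by rw [hrow, hBapp]) (fun s h0 h1 => ?_) x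
    have hMpos : (0 : ℝ) < ((M + 1 : ℕ) : ℝ) := by exact_mod_cast Nat.succ_pos M
    have hX : (B + (s : ℂ) • (A - B)).PosSemidef :=
      hBpsd.add (hu.smul (by exact_mod_cast h0))
    have := ih M (by omega) (fun j => ((j + 1 : ℕ) : ℝ) * d (j + 1))
      (fun j hj => mul_pos (by exact_mod_cast Nat.succ_pos j) (hd _ (by omega)))
      (t / ((M + 1 : ℕ) : ℝ))
      (by
        rw [le_div_iff₀ hMpos, mul_comm]
        exact (succ_mul_thresholdConst_le d N M hd ρ hρ (by omega)).trans ht)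
      ((B + (s : ℂ) • (A - B)).submatrix Fin.succ Fin.succ) (hX.submatrix _)
      (fun i j => by
        have e : ((B + (s : ℂ) • (A - B)).submatrix Fin.succ Fin.succ) i j =
            ((1 - s : ℝ) : ℂ) * B i.succ j.succ + (s : ℂ) * A i.succ j.succ := by
          simp
          ring
        rw [e]
        refine (norm_add_le _ _).trans ?_
        rw [norm_mul, norm_mul, Complex.norm_real, Complex.norm_real, Real.norm_of_nonneg h0,
          Real.norm_of_nonneg (by linarith)]
        nlinarith [hBρ i.succ j.succ, hAρ i.succ j.succ])
    have h2 := this.smul (a := ((M + 1 : ℕ) : ℂ)) (by exact_mod_cast hMpos.le)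
    convert h2 using 1
    ext i j
    simp

/-! ### Power series: summation and passage to the boundary -/

open scoped Matrix in
theorem posSemidef_map_pow {n : Type*} [Finite n] {A : Matrix n n ℂ} (hA : A.PosSemidef) :
    ∀ k : ℕ, (A.map fun z => z ^ k).PosSemidef
  | 0 => by
    convert Matrix.posSemidef_vecMulVec_self_star (fun _ : n => (1 : ℂ)) using 1
    ext i j
    simp [Matrix.vecMulVec_apply]
  | k + 1 => by
    have h : (A.map fun z => z ^ (k + 1)) = (A.map fun z => z ^ k) ⊙ A := by
      ext i j
      simp [pow_succ]
    rw [h]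
    exact (posSemidef_map_pow hA k).hadamard hA

theorem posSemidef_of_tendsto {n β : Type*} [Fintype n] {l : Filter β} [l.NeBot]
    {F : β → Matrix n n ℂ} {A : Matrix n n ℂ}
    (hF : ∀ i j, Tendsto (fun s => F s i j) l (𝓝 (A i j)))
    (hpos : ∀ᶠ s in l, (F s).PosSemidef) : A.PosSemidef := by
  rw [posSemidef_iff_re_sum_nonneg]
  constructor
  · ext i j
    refine tendsto_nhds_unique (((continuous_star.tendsto _).comp (hF j i)).congr' ?_) (hF i j)
    filter_upwards [hpos] with s hs
    exact hs.1.apply i j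
  · intro x
    have h : Tendsto (fun s => (∑ i, ∑ j, star (x i) * F s i j * x j).re) l
        (𝓝 (∑ i, ∑ j, star (x i) * A i j * x j).re) := by
      refine (Complex.continuous_re.tendsto _).comp ?_
      exact tendsto_finsetSum _ fun i _ => tendsto_finsetSum _ fun j _ =>
        ((hF i j).const_mul _).mul_const _
    refine ge_of_tendsto h ?_
    filter_upwards [hpos] with s hs
    exact ((posSemidef_iff_re_sum_nonneg _).1 hs).2 x

/-- Quadratic forms are compared term by term: the monomial case handles `c M > 0`, while for `c M ≤
0` the contribution to `g` is nonpositive because entrywise powers of `A` are positive semidefinite.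
-/
theorem posSemidef_map_sub_of_hasSum {ρ : ℝ} (hρ : 0 ≤ ρ) {N : ℕ} {c : ℕ → ℝ}
    (hc : ∀ j, j < N → 0 < c j) {g : ℂ → ℂ} {A : Matrix (Fin N) (Fin N) ℂ} (hA : A.PosSemidef)
    (hAρ : ∀ i j, ‖A i j‖ ≤ ρ)
    (hg : ∀ i j, HasSum (fun M : ℕ => if N ≤ M then (c M : ℂ) * A i j ^ M else 0) (g (A i j)))
    (hgA : (A.map g).IsHermitian)
    (hS : Summable (thresholdTerm c N ρ)) {t : ℝ} (ht : ∑' M, thresholdTerm c N ρ M ≤ t) :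
    (A.map fun z => (t : ℂ) * ∑ j ∈ Finset.range N, (c j : ℂ) * z ^ j - g z).PosSemidef := by
  rw [posSemidef_iff_re_sum_nonneg]
  set P : ℂ → ℂ := fun z => ∑ j ∈ Finset.range N, (c j : ℂ) * z ^ j with hP
  have hPpsd : (A.map P).PosSemidef := by
    have := Matrix.posSemidef_sum (Finset.range N)
      (x := fun j => (c j : ℂ) • A.map fun z => z ^ j) fun j hj =>
        (posSemidef_map_pow hA j).smul
          (by exact_mod_cast (hc j (Finset.mem_range.1 hj)).le : (0 : ℂ) ≤ (c j : ℂ))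
    convert this using 1
    ext i j
    simp [hP, Matrix.sum_apply]
  refine ⟨?_, fun x => ?_⟩
  · have h : (A.map fun z => (t : ℂ) * P z - g z) = (t : ℂ) • A.map P - A.map g := by
      ext i j
      simp
    rw [h]
    refine Matrix.IsHermitian.sub ?_ hgA
    ext i j
    have := hPpsd.1.apply i j
    simp only [Matrix.conjTranspose_apply, Matrix.smul_apply, smul_eq_mul, star_mul', this]
    simp
  · set Q : ℝ := (∑ i, ∑ j, star (x i) * P (A i j) * x j).re with hQ
    have hQ0 : 0 ≤ Q := ((posSemidef_iff_re_sum_nonneg _).1 hPpsd).2 x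
    set m : ℕ → ℝ := fun M => (∑ i, ∑ j, star (x i) * A i j ^ M * x j).re with hm
    have hsum : HasSum (fun M : ℕ => if N ≤ M then c M * m M else 0)
        (∑ i, ∑ j, star (x i) * g (A i j) * x j).re := by
      have h1 := hasSum_sum (s := Finset.univ) fun i (_ : i ∈ Finset.univ) =>
        hasSum_sum (s := Finset.univ) fun j (_ : j ∈ Finset.univ) =>
          ((hg i j).mul_left (star (x i))).mul_right (x j)
      have h2 := Complex.reCLM.hasSum h1
      refine h2.congr_fun fun M => ?_
      by_cases h : N ≤ M
      · simp only [if_pos h, Complex.reCLM_apply, hm]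
        rw [← Complex.re_ofReal_mul, Finset.mul_sum]
        congr 1
        refine Finset.sum_congr rfl fun i _ => ?_
        rw [Finset.mul_sum]
        exact Finset.sum_congr rfl fun j _ => by ring
      · simp [if_neg h]
    have hsplit : ∀ s : ℝ, ∀ f : ℂ → ℂ,
        (∑ i, ∑ j, star (x i) * ((s : ℂ) * P (A i j) - f (A i j)) * x j).re =
          s * Q - (∑ i, ∑ j, star (x i) * f (A i j) * x j).re := fun s f => by
      rw [hQ, ← Complex.re_ofReal_mul, ← Complex.sub_re, Finset.mul_sum, ← Finset.sum_sub_distrib]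
      congr 1
      refine Finset.sum_congr rfl fun i _ => ?_
      rw [Finset.mul_sum, ← Finset.sum_sub_distrib]
      exact Finset.sum_congr rfl fun j _ => by ring
    have hle : (∑ i, ∑ j, star (x i) * g (A i j) * x j).re ≤
        (∑' M, thresholdTerm c N ρ M) * Q := by
      refine hasSum_le (fun M => ?_) hsum (hS.hasSum.mul_right Q)
      by_cases h : N ≤ M
      · rw [if_pos h, thresholdTerm]
        by_cases hcM : 0 < c M
        · rw [if_pos ⟨h, hcM⟩, mul_assoc]
          refine mul_le_mul_of_nonneg_left ?_ hcM.le
          have h1 := ((posSemidef_iff_re_sum_nonneg _).1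
            (posSemidef_map_thresholdPoly ρ hρ N M h c hc _ le_rfl A hA hAρ)).2 x
          simp only [Matrix.map_apply, thresholdPoly] at h1
          have h2 := hsplit (thresholdConst c M N ρ) (fun z => z ^ M)
          simp only [hP] at h2
          rw [h2] at h1
          simp only [hm]
          linarith
        · rw [if_neg fun h' => hcM h'.2, zero_mul]
          exact mul_nonpos_of_nonpos_of_nonneg (not_lt.1 hcM)
            (((posSemidef_iff_re_sum_nonneg _).1 (posSemidef_map_pow hA M)).2 x)
      · rw [if_neg h, thresholdTerm, if_neg fun h' => h h'.1, zero_mul]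
    have h3 := hsplit t g
    simp only [Matrix.map_apply]
    rw [h3, sub_nonneg]
    exact hle.trans (mul_le_mul_of_nonneg_right ht hQ0)

/-- The series represents `g` only on the open disc, so the summed inequality is applied to `s • A`
with `s < 1`, and continuity of `g` yields the limit `s → 1`. -/
theorem posSemidef_threshold {ρ : ℝ} (hρ : 0 < ρ) {N : ℕ} {c : ℕ → ℝ}
    (hc : ∀ j, j < N → 0 < c j) {g : ℂ → ℂ}
    (hg : ∀ z ∈ Metric.ball (0 : ℂ) ρ,
      HasSum (fun M : ℕ => if N ≤ M then (c M : ℂ) * z ^ M else 0) (g z))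
    (hgc : ContinuousOn g (Metric.closedBall (0 : ℂ) ρ))
    (hS : Summable (thresholdTerm c N ρ)) {t : ℝ} (ht : ∑' M, thresholdTerm c N ρ M ≤ t)
    {A : Matrix (Fin N) (Fin N) ℂ} (hA : A.PosSemidef) (hAρ : ∀ i j, ‖A i j‖ ≤ ρ) :
    (A.map fun z => (t : ℂ) * ∑ j ∈ Finset.range N, (c j : ℂ) * z ^ j - g z).PosSemidef := by
  have hstar : ∀ z ∈ Metric.ball (0 : ℂ) ρ, g (star z) = star (g z) := fun z hz => by
    have h1 := (hg z hz).star
    have h2 := hg (star z) (by simpa using hz)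
    refine h2.unique (h1.congr_fun ?_)
    intro M
    by_cases h : N ≤ M <;> simp [h]
  have hmem : ∀ s ∈ Ioo (0 : ℝ) 1, ∀ i j, (s : ℂ) * A i j ∈ Metric.ball (0 : ℂ) ρ := by
    intro s hs i j
    rw [mem_ball_zero_iff, norm_mul, Complex.norm_real, Real.norm_of_nonneg hs.1.le]
    nlinarith [hAρ i j, hs.1, hs.2, norm_nonneg (A i j)]
  have hev : ∀ᶠ s : ℝ in 𝓝[<] 1, s ∈ Ioo (0 : ℝ) 1 := Ioo_mem_nhdsLT zero_lt_one
  refine posSemidef_of_tendsto (l := 𝓝[<] (1 : ℝ))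
    (F := fun s => ((s : ℂ) • A).map fun z =>
      (t : ℂ) * ∑ j ∈ Finset.range N, (c j : ℂ) * z ^ j - g z) (fun i j => ?_) ?_
  · have hs1 : Tendsto (fun s : ℝ => (s : ℂ) * A i j) (𝓝[<] 1) (𝓝 (A i j)) := by
      have : Continuous fun s : ℝ => (s : ℂ) * A i j := by fun_prop
      simpa using (this.tendsto 1).mono_left nhdsWithin_le_nhds
    have hgt : Tendsto (fun s : ℝ => g ((s : ℂ) * A i j)) (𝓝[<] 1) (𝓝 (g (A i j))) := by
      refine (hgc (A i j) (by simpa using hAρ i j)).tendsto.comp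
        (tendsto_nhdsWithin_iff.2 ⟨hs1, ?_⟩)
      filter_upwards [hev] with s hs
      exact Metric.ball_subset_closedBall (hmem s hs i j)
    have hpt : Tendsto (fun s : ℝ => (t : ℂ) * ∑ k ∈ Finset.range N,
        (c k : ℂ) * ((s : ℂ) * A i j) ^ k) (𝓝[<] 1)
        (𝓝 ((t : ℂ) * ∑ k ∈ Finset.range N, (c k : ℂ) * A i j ^ k)) :=
      (tendsto_finsetSum _ fun k _ => (hs1.pow k).const_mul _).const_mul _
    simpa using hpt.sub hgt
  · filter_upwards [hev] with s hs
    refine posSemidef_map_sub_of_hasSum hρ.le hc (hA.smul (by exact_mod_cast hs.1.le))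
      (fun i j => ?_) (fun i j => hg _ (hmem s hs i j)) ?_ hS ht
    · exact (mem_ball_zero_iff.1 (hmem s hs i j)).le
    · ext i j
      have := hstar _ (hmem s hs j i)
      simp only [Matrix.conjTranspose_apply, Matrix.map_apply, Matrix.smul_apply, smul_eq_mul]
      rw [← this, star_mul', hA.1.apply i j]
      simp

/-! ### Termwise differentiation with nonnegative coefficients -/

/-- The `n`-th term of the `k`-th termwise derivative of `∑ a n * x ^ e n`. -/
noncomputable def powerTermDeriv (a : ℕ → ℝ) (e : ℕ → ℕ) (k : ℕ) (x : ℝ) (n : ℕ) : ℝ :=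
  a n * (((e n).descFactorial k : ℝ) * x ^ (e n - k))

theorem powerTermDeriv_nonneg {a : ℕ → ℝ} (ha : ∀ n, 0 ≤ a n) (e : ℕ → ℕ) (k : ℕ) {x : ℝ}
    (hx : 0 ≤ x) (n : ℕ) : 0 ≤ powerTermDeriv a e k x n :=
  mul_nonneg (ha n) (mul_nonneg (Nat.cast_nonneg _) (pow_nonneg hx _))

theorem powerTermDeriv_mono {a : ℕ → ℝ} (ha : ∀ n, 0 ≤ a n) (e : ℕ → ℕ) (k : ℕ) {x y : ℝ}
    (hx : 0 ≤ x) (hxy : x ≤ y) (n : ℕ) :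
    powerTermDeriv a e k x n ≤ powerTermDeriv a e k y n :=
  mul_le_mul_of_nonneg_left (mul_le_mul_of_nonneg_left (pow_le_pow_left₀ hx hxy _)
    (Nat.cast_nonneg _)) (ha n)

theorem exists_descFactorial_mul_pow_le (k : ℕ) {x y : ℝ} (hx : 0 < x) (hxy : x < y) :
    ∃ K : ℝ, ∀ n : ℕ, (n.descFactorial k : ℝ) * x ^ (n - k) ≤ K * y ^ n := by
  have hy : 0 < y := hx.trans hxy
  have hr : ‖x / y‖ < 1 := by
    rw [Real.norm_of_nonneg (div_pos hx hy).le, div_lt_one hy]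
    exact hxy
  obtain ⟨K, hK⟩ :=
    (summable_pow_mul_geometric_of_norm_lt_one k hr).tendsto_atTop_zero.bddAbove_range
  refine ⟨K / x ^ k, fun n => ?_⟩
  have h1 : (n : ℝ) ^ k * (x / y) ^ n ≤ K := hK ⟨n, rfl⟩
  rcases lt_or_ge n k with h | h
  · rw [Nat.descFactorial_of_lt h, Nat.cast_zero, zero_mul]
    refine mul_nonneg (div_nonneg (le_trans ?_ h1) (pow_nonneg hx.le _)) (pow_nonneg hy.le _)
    positivity
  · have h2 : (n.descFactorial k : ℝ) ≤ (n : ℝ) ^ k := by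
      exact_mod_cast Nat.descFactorial_le_pow n k
    have h3 : x ^ (n - k) * x ^ k = x ^ n := by rw [← pow_add, Nat.sub_add_cancel h]
    rw [div_mul_eq_mul_div, le_div_iff₀ (pow_pos hx k), mul_assoc, h3]
    calc (n.descFactorial k : ℝ) * x ^ n ≤ (n : ℝ) ^ k * x ^ n :=
          mul_le_mul_of_nonneg_right h2 (pow_nonneg hx.le _)
      _ = ((n : ℝ) ^ k * (x / y) ^ n) * y ^ n := by
          rw [div_pow]; field_simp
      _ ≤ K * y ^ n := mul_le_mul_of_nonneg_right h1 (pow_nonneg hy.le _)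

theorem summable_powerTermDeriv {a : ℕ → ℝ} (ha : ∀ n, 0 ≤ a n) (e : ℕ → ℕ) (k : ℕ) {x y : ℝ}
    (hx : 0 < x) (hxy : x < y) (hs : Summable fun n => a n * y ^ e n) :
    Summable (powerTermDeriv a e k x) := by
  obtain ⟨K, hK⟩ := exists_descFactorial_mul_pow_le k hx hxy
  refine Summable.of_nonneg_of_le (powerTermDeriv_nonneg ha e k hx.le) (fun n => ?_)
    (hs.mul_left K)
  refine (mul_le_mul_of_nonneg_left (hK (e n)) (ha n)).trans (le_of_eq ?_)
  ring

theorem hasDerivAt_tsum_powerTermDeriv {a : ℕ → ℝ} (ha : ∀ n, 0 ≤ a n) (e : ℕ → ℕ) (k : ℕ)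
    {x y : ℝ} (hx : 0 < x) (hxy : x < y) (hs : Summable fun n => a n * y ^ e n) :
    HasDerivAt (fun z => ∑' n, powerTermDeriv a e k z n)
      (∑' n, powerTermDeriv a e (k + 1) x n) x := by
  -- On `(0, z)` the differentiated terms are dominated by their values at `z`, which are summable
  -- since `z < y`.
  obtain ⟨z, hxz, hzy⟩ := exists_between hxy
  refine hasDerivAt_tsum_of_isPreconnected (t := Ioo 0 z) (y₀ := x)
    (g := fun n z => powerTermDeriv a e k z n) (g' := fun n z => powerTermDeriv a e (k + 1) z n)
    (summable_powerTermDeriv ha e (k + 1) (hx.trans hxz) hzy hs) isOpen_Ioo isPreconnected_Ioo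
    (fun n w _ => ?_) (fun n w hw => ?_) ⟨hx, hxz⟩ (summable_powerTermDeriv ha e k hx hxy hs)
    ⟨hx, hxz⟩
  · have := ((hasDerivAt_pow (e n - k) w).const_mul ((e n).descFactorial k : ℝ)).const_mul (a n)
    refine this.congr_deriv ?_
    rw [powerTermDeriv, Nat.descFactorial_succ, Nat.sub_sub]
    push_cast
    ring
  · rw [Real.norm_of_nonneg (powerTermDeriv_nonneg ha e _ hw.1.le n)]
    exact powerTermDeriv_mono ha e _ hw.1.le hw.2.le n

theorem iteratedDeriv_tsum_pow {a : ℕ → ℝ} (ha : ∀ n, 0 ≤ a n) (e : ℕ → ℕ) {r : ℝ}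
    (hs : ∀ x ∈ Ioo 0 r, Summable fun n => a n * x ^ e n) (k : ℕ) :
    ∀ x ∈ Ioo 0 r, iteratedDeriv k (fun z => ∑' n, a n * z ^ e n) x =
      ∑' n, powerTermDeriv a e k x n := by
  induction k with
  | zero => intro x _; simp [powerTermDeriv]
  | succ k ih =>
    intro x hx
    obtain ⟨y, hxy, hyr⟩ := exists_between hx.2
    rw [iteratedDeriv_succ]
    have h : iteratedDeriv k (fun z => ∑' n, a n * z ^ e n) =ᶠ[𝓝 x]
        fun z => ∑' n, powerTermDeriv a e k z n := by
      filter_upwards [isOpen_Ioo.mem_nhds hx] with z hz using ih z hz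
    rw [h.deriv_eq]
    exact (hasDerivAt_tsum_powerTermDeriv ha e k hx.1 hxy (hs y ⟨hx.1.trans hxy, hyr⟩)).deriv

/-! ### Comparing the constants with derivatives of even powers -/

/-- The nonnegative coefficients of `gPlus`. -/
noncomputable def posCoeff (c : ℕ → ℝ) (N M : ℕ) : ℝ := if N ≤ M ∧ 0 < c M then c M else 0

theorem posCoeff_nonneg (c : ℕ → ℝ) (N M : ℕ) : 0 ≤ posCoeff c N M := by
  unfold posCoeff
  split_ifs with h
  exacts [h.2.le, le_rfl]

theorem gPlusTerm_eq (c : ℕ → ℝ) (N : ℕ) (x : ℝ) (M : ℕ) :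
    gPlusTerm c N x M = posCoeff c N M * x ^ M := by
  unfold gPlusTerm posCoeff
  split_ifs <;> simp

theorem gTwo_eq (c : ℕ → ℝ) (N : ℕ) :
    gTwo c N = fun x => ∑' M, posCoeff c N M * x ^ (2 * M) := by
  funext x
  simp only [gTwo, gPlus, gPlusTerm_eq, pow_mul]

theorem thresholdTerm_eq (c : ℕ → ℝ) (N : ℕ) (ρ : ℝ) (M : ℕ) :
    thresholdTerm c N ρ M = posCoeff c N M * thresholdConst c M N ρ := by
  unfold thresholdTerm posCoeff
  split_ifs <;> simp

/-- Consecutive factors are paired: `(2m+2)(2m+1) ≥ 2(m+1)^2`. This is the source of `2 ^ (N - 1)`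
in the bound. -/
theorem pow_two_mul_descFactorial_sq_le (M k : ℕ) (hk : k ≤ M) :
    2 ^ k * M.descFactorial k ^ 2 ≤ (2 * M).descFactorial (2 * k) := by
  induction k with
  | zero => simp
  | succ k ih =>
    have ih := ih (by omega)
    rw [show 2 * (k + 1) = 2 * k + 1 + 1 by ring, Nat.descFactorial_succ, Nat.descFactorial_succ,
      Nat.descFactorial_succ]
    obtain ⟨m, rfl⟩ : ∃ m, M = k + 1 + m := ⟨M - (k + 1), by omega⟩
    rw [show k + 1 + m - k = m + 1 by omega,
      show 2 * (k + 1 + m) - (2 * k + 1) = 2 * m + 1 by omega,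
      show 2 * (k + 1 + m) - 2 * k = 2 * (m + 1) by omega]
    calc 2 ^ (k + 1) * ((m + 1) * (k + 1 + m).descFactorial k) ^ 2
        = (m + 1) * (2 * (m + 1)) * (2 ^ k * (k + 1 + m).descFactorial k ^ 2) := by ring
      _ ≤ (2 * m + 1) * (2 * (m + 1)) * (2 * (k + 1 + m)).descFactorial (2 * k) := by
          refine Nat.mul_le_mul (Nat.mul_le_mul_right _ (by omega)) ih
      _ = _ := by ring

theorem factorial_mul_choose_mul_choose_le (M N j : ℕ) (hj : j < N) :
    (N - 1)! * (M.choose j * (M - j - 1).choose (N - j - 1)) ≤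
      (N - 1).choose j * M.descFactorial (N - 1) := by
  calc (N - 1)! * (M.choose j * (M - j - 1).choose (N - j - 1))
      ≤ (N - 1)! * (M.choose j * (M - j).choose (N - j - 1)) :=
        Nat.mul_le_mul_left _ (Nat.mul_le_mul_left _ (Nat.choose_le_choose _ (Nat.sub_le _ 1)))
    _ = (N - 1)! * (M.choose (N - 1) * (N - 1).choose j) := by
        rw [Nat.choose_mul (by omega : j ≤ N - 1), show N - 1 - j = N - j - 1 by omega]
    _ = _ := by
        rw [Nat.descFactorial_eq_factorial_mul_choose]
        ring

/-- This is the bound for `z ^ M` alone: the last argument is the `(2N-2)`-th derivative of `x ^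
(2M)` at `√ρ`. As `analyticBound` is linear in that argument, the general bound follows by
summation. -/
theorem thresholdConst_le_analyticBound (c : ℕ → ℝ) {N M : ℕ} (hN : 1 ≤ N) (hM : N ≤ M)
    (hc : ∀ j, j < N → 0 < c j) {ρ : ℝ} (hρ : 0 ≤ ρ) :
    thresholdConst c M N ρ ≤ analyticBound c N ρ
      (((2 * M).descFactorial (2 * N - 2) : ℝ) * √ρ ^ (2 * M - (2 * N - 2))) := by
  rw [analyticBound, thresholdConst, Finset.mul_sum]
  refine Finset.sum_le_sum fun j hj => ?_
  have hj := Finset.mem_range.1 hj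
  have hpow : √ρ ^ (2 * M - (2 * N - 2)) * ρ ^ (N - j - 1) = ρ ^ (M - j) := by
    rw [show 2 * M - (2 * N - 2) = 2 * (M - (N - 1)) by omega, pow_mul, Real.sq_sqrt hρ,
      ← pow_add]
    congr 1
    omega
  have hfac : (0 : ℝ) < ((N - 1)! : ℝ) := by exact_mod_cast Nat.factorial_pos _
  have h1 : (((N - 1)! : ℝ) * ((M.choose j : ℝ) * ((M - j - 1).choose (N - j - 1) : ℝ))) ^ 2 ≤
      (((N - 1).choose j : ℝ) * (M.descFactorial (N - 1) : ℝ)) ^ 2 :=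
    pow_le_pow_left₀ (by positivity)
      (by exact_mod_cast factorial_mul_choose_mul_choose_le M N j hj) 2
  have h2 : (2 : ℝ) ^ (N - 1) * (M.descFactorial (N - 1) : ℝ) ^ 2 ≤
      ((2 * M).descFactorial (2 * N - 2) : ℝ) := by
    have := pow_two_mul_descFactorial_sq_le M (N - 1) (by omega)
    rw [show 2 * (N - 1) = 2 * N - 2 by omega] at this
    exact_mod_cast this
  have h3 : (M.choose j : ℝ) ^ 2 * ((M - j - 1).choose (N - j - 1) : ℝ) ^ 2 ≤
      ((2 * M).descFactorial (2 * N - 2) : ℝ) / (2 ^ (N - 1) * ((N - 1)! : ℝ) ^ 2) *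
        ((N - 1).choose j : ℝ) ^ 2 := by
    rw [div_mul_eq_mul_div, le_div_iff₀ (by positivity)]
    nlinarith [mul_le_mul_of_nonneg_left h1 (by positivity : (0 : ℝ) ≤ 2 ^ (N - 1)),
      mul_le_mul_of_nonneg_right h2 (sq_nonneg ((N - 1).choose j : ℝ))]
  refine (mul_le_mul_of_nonneg_right h3 (div_nonneg (pow_nonneg hρ _) (hc j hj).le)).trans
    (le_of_eq ?_)
  rw [← hpow]
  ring

theorem thresholdTerm_bound (c : ℕ → ℝ) {N : ℕ} (hN : 1 ≤ N)
    (hc : ∀ j, j < N → 0 < c j) {ρ D : ℝ} (hρ : 0 ≤ ρ)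
    (hs : Summable (powerTermDeriv (posCoeff c N) (fun M => 2 * M) (2 * N - 2) √ρ))
    (hD : ∑' M, powerTermDeriv (posCoeff c N) (fun M => 2 * M) (2 * N - 2) √ρ M ≤ D) :
    Summable (thresholdTerm c N ρ) ∧
      ∑' M, thresholdTerm c N ρ M ≤ analyticBound c N ρ D := by
  set K : ℝ := 1 / (2 ^ (N - 1) * ((N - 1)! : ℝ) ^ 2) *
    ∑ j ∈ Finset.range N, ((N - 1).choose j : ℝ) ^ 2 * (ρ ^ (N - j - 1) / c j) with hK
  have hsum0 : 0 ≤ ∑ j ∈ Finset.range N, ((N - 1).choose j : ℝ) ^ 2 * (ρ ^ (N - j - 1) / c j) :=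
    Finset.sum_nonneg fun j hj => mul_nonneg (sq_nonneg _)
      (div_nonneg (pow_nonneg hρ _) (hc j (Finset.mem_range.1 hj)).le)
  have hK0 : 0 ≤ K := mul_nonneg (by positivity) hsum0
  have hbound : ∀ E, analyticBound c N ρ E = E * K := fun E => by
    rw [analyticBound, hK]
    ring
  have hle : ∀ M, thresholdTerm c N ρ M ≤
      powerTermDeriv (posCoeff c N) (fun M => 2 * M) (2 * N - 2) √ρ M * K := fun M => by
    rw [thresholdTerm_eq, powerTermDeriv, mul_assoc, ← hbound]
    by_cases h : N ≤ M
    · exact mul_le_mul_of_nonneg_left (thresholdConst_le_analyticBound c hN h hc hρ)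
        (posCoeff_nonneg _ _ _)
    · simp [posCoeff, h]
  have hnn : ∀ M, 0 ≤ thresholdTerm c N ρ M := fun M => by
    rw [thresholdTerm_eq]
    exact mul_nonneg (posCoeff_nonneg _ _ _) (Finset.sum_nonneg fun j hj =>
      mul_nonneg (mul_nonneg (sq_nonneg _) (sq_nonneg _))
        (div_nonneg (pow_nonneg hρ _) (hc j (Finset.mem_range.1 hj)).le))
  have hS : Summable (thresholdTerm c N ρ) :=
    Summable.of_nonneg_of_le hnn hle (hs.mul_right K)
  refine ⟨hS, (hS.tsum_le_tsum hle (hs.mul_right K)).trans ?_⟩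
  rw [tsum_mul_right, hbound]
  exact mul_le_mul_of_nonneg_right hD hK0

/-! ### Boundary values and the main theorem -/

/-- A nonnegative monotone function on `(0, b)` has a limit at `b` in `[0, ∞]`, which bounds it. -/
theorem exists_tendsto_ennreal_of_monotoneOn {F : ℝ → ℝ} {b : ℝ} (hb : 0 < b)
    (h0 : ∀ x ∈ Ioo 0 b, 0 ≤ F x) (hF : MonotoneOn F (Ioo 0 b)) :
    ∃ D : ℝ≥0∞, Tendsto (fun x : ℝ => (F x : EReal)) (𝓝[<] b) (𝓝 (D : EReal)) ∧
      (D ≠ ∞ → ∀ x ∈ Ioo 0 b, F x ≤ D.toReal) := by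
  set D : ℝ≥0∞ := ⨆ x ∈ Ioo 0 b, ENNReal.ofReal (F x) with hD
  have hle : ∀ x ∈ Ioo 0 b, ENNReal.ofReal (F x) ≤ D := fun x hx =>
    le_iSup₂ (f := fun x (_ : x ∈ Ioo 0 b) => ENNReal.ofReal (F x)) x hx
  refine ⟨D, ?_, fun hDt x hx => ?_⟩
  · have hev : ∀ᶠ x in 𝓝[<] b, x ∈ Ioo 0 b := Ioo_mem_nhdsLT hb
    have h1 : Tendsto (fun x => ENNReal.ofReal (F x)) (𝓝[<] b) (𝓝 D) := by
      refine tendsto_order.2 ⟨fun d hd => ?_, fun d hd => ?_⟩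
      · obtain ⟨x, hx⟩ := lt_iSup_iff.1 hd
        obtain ⟨hx, hdx⟩ := lt_iSup_iff.1 hx
        filter_upwards [Ioo_mem_nhdsLT hx.2] with y hy
        exact hdx.trans_le (ENNReal.ofReal_le_ofReal
          (hF hx ⟨hx.1.trans hy.1, hy.2⟩ hy.1.le))
      · filter_upwards [hev] with x hx using (hle x hx).trans_lt hd
    refine ((continuous_coe_ennreal_ereal.tendsto D).comp h1).congr' ?_
    filter_upwards [hev] with x hx
    simp [EReal.coe_ennreal_ofReal, h0 x hx]
  · exact (ENNReal.ofReal_le_iff_le_toReal hDt).1 (hle x hx)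

/-- Each finite partial sum is continuous and at most `D` inside the interval, hence at most `D` at
the endpoint; nonnegativity does the rest. -/
theorem summable_powerTermDeriv_of_le {a : ℕ → ℝ} (ha : ∀ n, 0 ≤ a n) (e : ℕ → ℕ) (k : ℕ)
    {b D : ℝ} (hb : 0 < b) (hs : ∀ x ∈ Ioo 0 b, Summable (powerTermDeriv a e k x))
    (hD : ∀ x ∈ Ioo 0 b, ∑' n, powerTermDeriv a e k x n ≤ D) :
    Summable (powerTermDeriv a e k b) ∧ ∑' n, powerTermDeriv a e k b n ≤ D := by
  have hfin : ∀ n, ∑ i ∈ Finset.range n, powerTermDeriv a e k b i ≤ D := fun n => by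
    have hcont : Continuous fun x => ∑ i ∈ Finset.range n, powerTermDeriv a e k x i := by
      unfold powerTermDeriv
      fun_prop
    refine le_of_tendsto ((hcont.tendsto b).mono_left (nhdsWithin_le_nhds (s := Iio b))) ?_
    filter_upwards [Ioo_mem_nhdsLT hb] with x hx
    exact ((hs x hx).sum_le_tsum _ fun i _ => powerTermDeriv_nonneg ha e k hx.1.le i).trans
      (hD x hx)
  have hnn := powerTermDeriv_nonneg ha e k hb.le
  exact ⟨summable_of_sum_range_le hnn hfin, Real.tsum_le_of_sum_range_le hnn hfin⟩

theorem summable_posCoeff_of_hasSum {ρ : ℝ} {N : ℕ} {c : ℕ → ℝ} {g : ℂ → ℂ}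
    (hg : ∀ z ∈ Metric.ball (0 : ℂ) ρ,
      HasSum (fun M : ℕ => if N ≤ M then (c M : ℂ) * z ^ M else 0) (g z))
    {x : ℝ} (hx0 : 0 ≤ x) (hx : x < ρ) : Summable fun M => posCoeff c N M * x ^ M := by
  have h := (hg (x : ℂ) (by simpa [abs_of_nonneg hx0] using hx)).summable.norm
  refine Summable.of_nonneg_of_le
    (fun M => mul_nonneg (posCoeff_nonneg _ _ _) (pow_nonneg hx0 _)) (fun M => ?_) h
  by_cases h : N ≤ M ∧ 0 < c M
  · simp [posCoeff, h, abs_of_nonneg hx0, abs_of_pos h.2]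
  · rw [posCoeff, if_neg h, zero_mul]
    exact norm_nonneg _

theorem theorem1p3 (ρ : ℝ) (hρ : 0 < ρ) (N : ℕ) (hN : 1 ≤ N)
    (c : ℕ → ℝ) (hc : ∀ j, j < N → 0 < c j)
    (g : ℂ → ℂ)
    (hg : ∀ z ∈ Metric.ball (0 : ℂ) ρ,
      HasSum (fun M : ℕ => if N ≤ M then (c M : ℂ) * z ^ M else 0) (g z))
    (hgc : ContinuousOn g (Metric.closedBall (0 : ℂ) ρ)) :
    -- positivity, for every real `t` that is at least the sum of the series
    (Summable (thresholdTerm c N ρ) →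
      ∀ t : ℝ, ∑' M, thresholdTerm c N ρ M ≤ t →
      ∀ A ∈ psdMatrices N (Metric.closedBall (0 : ℂ) ρ),
        (t : ℂ) • (∑ j ∈ Finset.range N, (c j : ℂ) • hadamardPow A j) - A.map g
          ∈ psdMatrices N Set.univ) ∧
    -- the boundary value `D` in `[0, ∞]` of the derivative of `gTwo` at `√ρ` exists, and
    -- the series is bounded in terms of it (for `D = ∞` the bound is `∞`)
    (∃ D : ℝ≥0∞,
      Tendsto (fun x : ℝ => ((iteratedDeriv (2 * N - 2) (gTwo c N) x : ℝ) : EReal))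
        (𝓝[<] √ρ) (𝓝 (D : EReal)) ∧
      (D ≠ ∞ → Summable (thresholdTerm c N ρ) ∧
        ∑' M, thresholdTerm c N ρ M ≤ analyticBound c N ρ D.toReal)) ∧
    -- if the power series of `gPlus` converges beyond `ρ`, then the series converges and is
    -- bounded in terms of the actual derivative at `√ρ`
    ((∃ R : ℝ, ρ < R ∧ Summable (gPlusTerm c N R)) →
      Summable (thresholdTerm c N ρ) ∧
        ∑' M, thresholdTerm c N ρ M ≤
          analyticBound c N ρ (iteratedDeriv (2 * N - 2) (gTwo c N) √ρ)) := by
  have hρ' : 0 < √ρ := Real.sqrt_pos.2 hρ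
  have ha := posCoeff_nonneg c N
  refine ⟨fun hS t ht A hA => ⟨?_, fun _ _ => mem_univ _⟩, ?_, ?_⟩
  · have := posSemidef_threshold hρ hc hg hgc hS ht hA.1
      fun i j => by simpa using hA.2 i j
    convert this using 1
    ext i j
    simp [Matrix.sum_apply, hadamardPow]
  · have hs0 : ∀ x ∈ Ioo 0 √ρ, Summable fun M => posCoeff c N M * x ^ (2 * M) := fun x hx => by
      have := summable_posCoeff_of_hasSum hg (sq_nonneg x) ((Real.lt_sqrt hx.1.le).1 hx.2)
      simpa only [pow_mul] using this
    have hs : ∀ k, ∀ x ∈ Ioo 0 √ρ,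
        Summable (powerTermDeriv (posCoeff c N) (fun M => 2 * M) k x) := fun k x hx => by
      obtain ⟨y, hxy, hy⟩ := exists_between hx.2
      exact summable_powerTermDeriv ha _ k hx.1 hxy (hs0 y ⟨hx.1.trans hxy, hy⟩)
    have hder := iteratedDeriv_tsum_pow ha (fun M => 2 * M) hs0 (2 * N - 2)
    rw [← gTwo_eq] at hder
    obtain ⟨D, hD, hDle⟩ := exists_tendsto_ennreal_of_monotoneOn
      (F := iteratedDeriv (2 * N - 2) (gTwo c N)) hρ'
      (fun x hx => by
        rw [hder x hx]
        exact tsum_nonneg (powerTermDeriv_nonneg ha _ _ hx.1.le))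
      (fun x hx y hy hxy => by
        rw [hder x hx, hder y hy]
        exact (hs _ x hx).tsum_le_tsum (powerTermDeriv_mono ha _ _ hx.1.le hxy) (hs _ y hy))
    refine ⟨D, hD, fun hDt => ?_⟩
    have h := summable_powerTermDeriv_of_le ha (fun M => 2 * M) (2 * N - 2) hρ' (hs _)
      fun x hx => hder x hx ▸ hDle hDt x hx
    exact thresholdTerm_bound c hN hc hρ.le h.1 h.2
  · rintro ⟨R, hR, hsR⟩
    have hR0 : 0 < R := hρ.trans hR
    have hlt : √ρ < √R := Real.sqrt_lt_sqrt hρ.le hR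
    have hsR' : Summable fun M => posCoeff c N M * √R ^ (2 * M) := by
      simpa only [pow_mul, Real.sq_sqrt hR0.le] using hsR.congr (gPlusTerm_eq c N R)
    have hs0 : ∀ x ∈ Ioo 0 √R, Summable fun M => posCoeff c N M * x ^ (2 * M) := fun x hx =>
      Summable.of_nonneg_of_le (fun M => mul_nonneg (ha M) (pow_nonneg hx.1.le _))
        (fun M => mul_le_mul_of_nonneg_left (pow_le_pow_left₀ hx.1.le hx.2.le _) (ha M)) hsR'
    have hder := iteratedDeriv_tsum_pow ha (fun M => 2 * M) hs0 (2 * N - 2) √ρ ⟨hρ', hlt⟩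
    rw [← gTwo_eq] at hder
    exact thresholdTerm_bound c hN hc hρ.le
      (summable_powerTermDeriv ha _ _ hρ' hlt hsR') hder.ge
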